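/- Let $n,d\ge 1$ and let $X=(X_1,\dots,X_n)$ be i.i.d. $N_d(\mu,\sigma^2 I_d)$ with $\theta=(\mu,\sigma^2)\in\mathbb{R}^d\times(0,\infty)$ unknown. Let $\beta:[0,\infty)\to[0,\infty)$ be strictly increasing and absolutely continuous on every interval $[0,b]$, let $Z\sim\chi^2_d$, and assume $\mathbb{E}\,\beta(Z)<\infty$. Consider estimating the loss $$L=\beta\Big(\frac{\|\bar X-\mu\|^2}{\sigma^2/n}\Big)$$ incurred by the sample mean $\bar X$ as an estimator of $\mu$. A loss estimator is a measurable function $\hat L(X)$ of the sample with values in $(0,\infty)$. Under a second-stage loss $\rho(\hat L/L)$ its risk is $R(\theta,\hat L)=\mathbb{E}_\theta\,\rho(\hat L(X)/L)\in[0,\infty]$, and $\hat L$ is minimax if $\sup_\theta R(\theta,\hat L)=\inf_{T}\sup_\theta R(\theta,T)$, where the supremum is over all $(\mu,\sigma^2)\in\mathbb{R}^d\times(0,\infty)$ and the infimum over all loss estimators $T$. For known $\sigma^2$, a generalized Bayes estimator with respect to the uniform prior density $\pi_0(\mu)=1$ on $\mathbb{R}^d$ is one that minimizes, at every sample point $x$,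 the expected posterior loss $\mathbb{E}\big(\rho(\hat L/L)\,|\,x\big)$ over $\hat L\in(0,\infty)$. In each of the following four cases, the indicated constant $\hat L_{\pi_0}$ (used for every $x$) is, for every known value of $\sigma^2$, the unique generalized Bayes estimator of $L$ with respect to $\pi_0$; it is minimax when $\mu$ and $\sigma^2$ are both unknown; and its risk is constant in $(\mu,\sigma^2)$ with the indicated finite value $\bar R$, which is therefore the minimax risk. 1. $\rho_m(t)=t^m-m\log t-1$ with $m\ne 0$, if $\mathbb{E}\log\beta(Z)$ and $\mathbb{E}\,\beta(Z)^{-m}$ exist and are finite: $$\hat L_{\pi_0}=\big\{\mathbb{E}\,\beta(Z)^{-m}\big\}^{-1/m},\qquad \bar R=m\,\mathbb{E}\log\beta(Z)+\log\mathbb{E}\,\beta(Z)^{-m}.$$ 2. $\rho_A(t)=(t^m-1)^2$ with $m\neq 0$, if $\mathbb{E}\,\beta(Z)^{-m}$ and $\mathbb{E}\,\beta(Z)^{-2m}$ are finite: $$\hat L_{\pi_0}=\Big\{\frac{\mathbb{E}\,\beta(Z)^{-m}}{\mathbb{E}\,\beta(Z)^{-2m}}\Big\}^{1/m},\qquad \bar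 R=1-\frac{(\mathbb{E}\,\beta(Z)^{-m})^2}{\mathbb{E}\,\beta(Z)^{-2m}}.$$ 3. $\rho_B(t)=\tfrac12\big(t+\tfrac1t-2\big)$, if $\mathbb{E}\,\tfrac{1}{\beta(Z)}$ is finite: $$\hat L_{\pi_0}=\sqrt{\frac{\mathbb{E}\,\beta(Z)}{\mathbb{E}\frac{1}{\beta(Z)}}},\qquad \bar R=\sqrt{\mathbb{E}\,\beta(Z)\;\mathbb{E}\tfrac{1}{\beta(Z)}}-1.$$ 4. $\rho_C(t)=(\log t)^2$, if $\mathbb{E}\,(\log\beta(Z))^2$ is finite: $$\hat L_{\pi_0}=e^{\mathbb{E}\log\beta(Z)},\qquad \bar R=\operatorname{Var}\big(\log\beta(Z)\big).$$ -/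

import Mathlib

open MeasureTheory ProbabilityTheory
open scoped ENNReal

namespace LossEstimation

noncomputable section

/-- The space `ℝ^d` with its Euclidean norm. -/
abbrev Vec (d : ℕ) : Type := EuclideanSpace ℝ (Fin d)

/-- A sample `(x_1, …, x_n)` of points of `ℝ^d`. -/
abbrev Sample (n d : ℕ) : Type := Fin n → Vec d

/-- The law of an i.i.d. sample of size `n` from `N_d(μ, σ² I_d)`; the parameter is `θ = (μ, σ²)`
with `σ2` standing for the variance `σ²`. -/
def sampleLaw (n d : ℕ) (μ : Vec d) (σ2 : ℝ) : Measure (Sample n d) :=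
  Measure.pi fun _ => multivariateGaussian μ (σ2 • (1 : Matrix (Fin d) (Fin d) ℝ))

/-- The chi-squared distribution with `d` degrees of freedom: the law of `‖G‖²`, `G ∼ N_d(0, I_d)`. -/
def chiSq (d : ℕ) : Measure ℝ := (stdGaussian (Vec d)).map fun g => ‖g‖ ^ 2

/-- The sample mean. -/
def sampleMean {n d : ℕ} (x : Sample n d) : Vec d := (n : ℝ)⁻¹ • ∑ i, x i

/-- The first-stage loss `L = β(‖x̄ - μ‖² / (σ²/n))` incurred by the sample mean as an estimate
of `μ`. -/
def firstLoss {n d : ℕ} (β : ℝ → ℝ) (μ : Vec d) (σ2 : ℝ) (x : Sample n d) : ℝ :=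
  β (‖sampleMean x - μ‖ ^ 2 / (σ2 / n))

/-- The second-stage loss `W(L, L̂) = ρ(L̂ / L)` as an extended nonnegative number; every `ρ` used
below is nonnegative on `(0, ∞)`. -/
def secondLoss (ρ : ℝ → ℝ) (L Lhat : ℝ) : ℝ≥0∞ := ENNReal.ofReal (ρ (Lhat / L))

/-- Loss estimators: measurable functions of the sample with values in `(0, ∞)`.  They may not
depend on the parameters `μ` and `σ²`. -/
def IsLossEstimator {n d : ℕ} (Lhat : Sample n d → ℝ) : Prop :=
  Measurable Lhat ∧ ∀ x, 0 < Lhat x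

/-- The frequentist risk `R(θ, L̂) = E_θ W(L, L̂(X))`, possibly infinite, at `θ = (μ, σ²)`. -/
def risk {n d : ℕ} (β ρ : ℝ → ℝ) (Lhat : Sample n d → ℝ) (μ : Vec d) (σ2 : ℝ) : ℝ≥0∞ :=
  ∫⁻ x, secondLoss ρ (firstLoss β μ σ2 x) (Lhat x) ∂(sampleLaw n d μ σ2)

/-- The supremum of the risk over all `θ = (μ, σ²)` with `μ ∈ ℝ^d` and `σ² > 0` both unknown. -/
def supRisk {n d : ℕ} (β ρ : ℝ → ℝ) (Lhat : Sample n d → ℝ) : ℝ≥0∞ :=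
  ⨆ (μ : Vec d) (σ2 : ℝ) (_ : 0 < σ2), risk β ρ Lhat μ σ2

/-- Minimaxity, with `μ` and `σ²` unknown, among all loss estimators. -/
def IsMinimax {n d : ℕ} (β ρ : ℝ → ℝ) (Lhat : Sample n d → ℝ) : Prop :=
  IsLossEstimator Lhat ∧
    supRisk β ρ Lhat = ⨅ (T : Sample n d → ℝ) (_ : IsLossEstimator T), supRisk β ρ T

/-- The joint Lebesgue density of the sample at `x` under `N_d(μ, σ² I_d)`. -/
def likelihood {n d : ℕ} (μ : Vec d) (σ2 : ℝ) (x : Sample n d) : ℝ :=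
  ∏ i, (2 * Real.pi * σ2) ^ (-(d : ℝ) / 2) * Real.exp (-‖x i - μ‖ ^ 2 / (2 * σ2))

/-- The expected posterior loss of the estimate `c` of `L` given the data `x`, when `σ²` is known and
`μ` has the uniform (improper) prior density `π₀(μ) = 1` on `ℝ^d`. -/
def posteriorLoss {n d : ℕ} (β ρ : ℝ → ℝ) (σ2 : ℝ) (x : Sample n d) (c : ℝ) : ℝ≥0∞ :=
  (∫⁻ μ : Vec d, secondLoss ρ (firstLoss β μ σ2 x) c * ENNReal.ofReal (likelihood μ σ2 x)) /
    ∫⁻ μ : Vec d, ENNReal.ofReal (likelihood μ σ2 x)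

/-- `L̂` is a generalized Bayes estimator of `L` with respect to the uniform prior on `μ`, for the
known variance `σ²`: at every `x` it minimizes the expected posterior loss over `(0, ∞)`. -/
def IsGeneralizedBayes {n d : ℕ} (β ρ : ℝ → ℝ) (σ2 : ℝ) (Lhat : Sample n d → ℝ) : Prop :=
  ∀ x, 0 < Lhat x ∧ ∀ c, 0 < c → posteriorLoss β ρ σ2 x (Lhat x) ≤ posteriorLoss β ρ σ2 x c

/-- Entropy-type loss `ρ_m(t) = t^m - m log t - 1`. -/
def rhoEntropy (m t : ℝ) : ℝ := t ^ m - m * Real.log t - 1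

/-- `ρ_A(t) = (t^m - 1)²`. -/
def rhoA (m t : ℝ) : ℝ := (t ^ m - 1) ^ 2

/-- `ρ_B(t) = (t + 1/t - 2) / 2`. -/
def rhoB (t : ℝ) : ℝ := (t + 1 / t - 2) / 2

/-- `ρ_C(t) = (log t)²`. -/
def rhoC (t : ℝ) : ℝ := Real.log t ^ 2

/-- The estimate `c`, used whatever the data, is the unique generalized Bayes estimator for every
known value of `σ²`; it is minimax when `μ` and `σ²` are both unknown; and its risk has the constant
finite value `r`, for all `μ` and `σ²`. -/
def IsBayesMinimax (n d : ℕ) (β ρ : ℝ → ℝ) (c r : ℝ) : Prop :=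
  (∀ σ2 : ℝ, 0 < σ2 → ∀ Lhat : Sample n d → ℝ,
    IsGeneralizedBayes β ρ σ2 Lhat ↔ Lhat = fun _ => c) ∧
  IsMinimax β ρ (fun _ : Sample n d => c) ∧
  ∀ (μ : Vec d) (σ2 : ℝ), 0 < σ2 →
    risk β ρ (fun _ : Sample n d => c) μ σ2 = ENNReal.ofReal r

end

end LossEstimation

open LossEstimation

/-! The variable √(n/σ²)(x̄ − μ) is a pivot: it is standard Gaussian under the sampling law and, up
to sign, under the posterior for the flat prior. So for a constant estimate c the risk and the
posterior loss are the same number, E ρ(c/β(‖g‖²)) with g standard Gaussian (`risk_const`,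
`posteriorLoss_eq`). The Bayes property, its uniqueness and the value of the risk all come from
minimizing this number over c > 0. The minimum is strict and explicit, by log x ≤ x − 1 or by
completing a square.

Minimaxity needs a lower bound on the supremum of the risk of an arbitrary T (`le_supRisk`). One
variance is enough; at σ² = n the sample mean is w = μ + u, with u standard Gaussian and independent
of the residuals (`indepFun_sampleMean_residual`). Once w and the residuals are fixed, T is a number
c while the loss depends on u alone. Let μ be uniform on a ball of radius k and exchange μ for w: if
‖u‖ ≤ M and ‖w‖ < k − M, then ‖μ‖ < k. Up to the factor (1 − M/k)^d, which tends to 1, the average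
risk is therefore at least the minimum over c of the integral truncated to ‖u‖ ≤ M
(`le_of_forall_lintegral_translate_le`).

The truncated minima have the same closed form with moments of the Gaussian restricted to a ball, so
they converge to the constant risk as M → ∞; `isBayesMinimax_of_truncation` concludes. -/

/-- The law of a sample of standard Gaussian vectors. -/
noncomputable abbrev stdSampleLaw (n d : ℕ) : Measure (Sample n d) :=
  Measure.pi fun _ => stdGaussian (Vec d)

/-! ### Gaussian samples: standardization, law of the mean, independence from the residuals -/

theorem map_stdGaussian_eq_multivariateGaussian {d : ℕ} (μ : Vec d) {σ2 : ℝ} (h : 0 ≤ σ2) :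
    (stdGaussian (Vec d)).map (fun y => μ + √σ2 • y)
      = multivariateGaussian μ (σ2 • (1 : Matrix (Fin d) (Fin d) ℝ)) := by
  have hmap : (stdGaussian (Vec d)).map (fun y => μ + √σ2 • y)
      = ((stdGaussian (Vec d)).map (fun y => √σ2 • y)).map (fun y => μ + y) := by
    rw [Measure.map_map (by fun_prop) (by fun_prop)]; rfl
  have : IsProbabilityMeasure ((stdGaussian (Vec d)).map (fun y => √σ2 • y)) :=
    Measure.isProbabilityMeasure_map (by fun_prop)
  have : IsProbabilityMeasure
      (((stdGaussian (Vec d)).map (fun y => √σ2 • y)).map (fun y => μ + y)) :=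
    Measure.isProbabilityMeasure_map (by fun_prop)
  rw [hmap]
  apply Measure.ext_of_charFun
  ext t
  rw [charFun_map_const_add, charFun_map_smul, charFun_stdGaussian,
    charFun_multivariateGaussian (Matrix.PosSemidef.one.smul h), ← Complex.exp_add]
  congr 1
  have hq : t.ofLp ⬝ᵥ (σ2 • (1 : Matrix (Fin d) (Fin d) ℝ)).mulVec t.ofLp = ‖√σ2 • t‖ ^ 2 := by
    rw [Matrix.smul_mulVec, Matrix.one_mulVec, dotProduct_smul, norm_smul, mul_pow,
      Real.norm_eq_abs, sq_abs, Real.sq_sqrt h, EuclideanSpace.real_norm_sq_eq, dotProduct]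
    simp only [← pow_two, smul_eq_mul]
  rw [hq, real_inner_comm]
  push_cast
  ring

theorem sampleLaw_eq_map {n d : ℕ} (μ : Vec d) {σ2 : ℝ} (h : 0 ≤ σ2) :
    sampleLaw n d μ σ2 = (stdSampleLaw n d).map fun y i => μ + √σ2 • y i := by
  have (i : Fin n) : SigmaFinite ((stdGaussian (Vec d)).map (fun y => μ + √σ2 • y)) := by
    rw [map_stdGaussian_eq_multivariateGaussian μ h]; infer_instance
  rw [stdSampleLaw, Measure.pi_map_pi (f := fun _ y => μ + √σ2 • y)
    fun _ => Measurable.aemeasurable (by fun_prop), sampleLaw]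
  simp only [map_stdGaussian_eq_multivariateGaussian μ h]

theorem measurable_sampleMean {n d : ℕ} : Measurable (sampleMean : Sample n d → Vec d) := by
  unfold sampleMean; fun_prop

theorem sampleMean_const_add_smul {n d : ℕ} (hn : 1 ≤ n) (μ : Vec d) (s : ℝ) (y : Sample n d) :
    sampleMean (fun i => μ + s • y i) = μ + s • sampleMean y := by
  have : (n : ℝ) ≠ 0 := by positivity
  simp only [sampleMean, Finset.sum_add_distrib, Finset.sum_const, Finset.card_univ,
    Fintype.card_fin, ← Finset.smul_sum, smul_add, ← Nat.cast_smul_eq_nsmul ℝ, smul_smul,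
    inv_mul_cancel₀ this, one_smul, mul_comm]

/-- Independence splits the characteristic function into n equal factors, and the scale √n · n⁻¹
makes their exponents add up to −‖t‖²/2. -/
theorem map_sampleMean_stdSampleLaw {n d : ℕ} (hn : 1 ≤ n) :
    (stdSampleLaw n d).map (fun y => √n • sampleMean y) = stdGaussian (Vec d) := by
  have hn' : (0 : ℝ) < n := by positivity
  have hm : Measurable fun y : Sample n d => √n • sampleMean y :=
    measurable_sampleMean.const_smul (√(n : ℝ))
  have : IsProbabilityMeasure ((stdSampleLaw n d).map (fun y => √n • sampleMean y)) :=
    Measure.isProbabilityMeasure_map hm.aemeasurable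
  apply Measure.ext_of_charFun
  ext t
  have key (y : Sample n d) : Complex.exp ((inner ℝ (√n • sampleMean y) t : ℝ) * Complex.I)
      = ∏ i, Complex.exp ((inner ℝ (y i) ((√n * (n : ℝ)⁻¹) • t) : ℝ) * Complex.I) := by
    rw [← Complex.exp_sum, ← Finset.sum_mul, ← Complex.ofReal_sum, ← sum_inner, sampleMean,
      smul_smul, real_inner_smul_left, real_inner_smul_right]
  rw [charFun_apply, integral_map hm.aemeasurable
    (Measurable.aestronglyMeasurable (by fun_prop))]
  simp_rw [key]
  rw [stdSampleLaw, integral_fintype_prod_eq_prod (f := fun (_ : Fin n) (y : Vec d) =>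
    Complex.exp ((inner ℝ y ((√n * (n : ℝ)⁻¹) • t) : ℝ) * Complex.I))]
  simp_rw [← charFun_apply, charFun_stdGaussian]
  rw [Finset.prod_const, Finset.card_univ, Fintype.card_fin, ← Complex.exp_nat_mul]
  congr 1
  have : (n : ℝ) * ‖(√n * (n : ℝ)⁻¹) • t‖ ^ 2 = ‖t‖ ^ 2 := by
    rw [norm_smul, mul_pow, Real.norm_eq_abs, sq_abs, mul_pow, Real.sq_sqrt hn'.le]
    field_simp
  rw [mul_div_assoc', mul_neg]
  exact_mod_cast congrArg (fun r : ℝ => -(r : ℂ) / 2) this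

theorem covariance_sum_pi_dual {n : ℕ} {E : Type*} [NormedAddCommGroup E] [NormedSpace ℝ E]
    [MeasurableSpace E] [BorelSpace E] [CompleteSpace E] [SecondCountableTopology E]
    (γ : Measure E) [IsGaussian γ]
    (a b : Fin n → StrongDual ℝ E) :
    cov[fun y : Fin n → E => ∑ i, a i (y i), fun y => ∑ i, b i (y i);
      Measure.pi fun _ => γ] = ∑ i, cov[a i, b i; γ] := by
  have hmp (i : Fin n) := measurePreserving_eval (fun _ : Fin n => γ) i
  have hLp (L : StrongDual ℝ E) (i : Fin n) :
      MemLp (fun y : Fin n → E => L (y i)) 2 (Measure.pi fun _ => γ) :=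
    (IsGaussian.memLp_dual γ L 2 (by simp)).comp_measurePreserving (hmp i)
  have hind : iIndepFun (fun i (y : Fin n → E) => y i) (Measure.pi fun _ => γ) :=
    iIndepFun_pi (X := fun _ x => x) fun _ => aemeasurable_id
  rw [covariance_fun_sum_fun_sum (fun i => hLp _ i) (fun i => hLp _ i)]
  refine Finset.sum_congr rfl fun i _ => ?_
  rw [Finset.sum_eq_single i]
  · conv_rhs => rw [← (hmp i).map_eq]
    rw [covariance_map (by fun_prop) (by fun_prop) (hmp i).aemeasurable]
    rfl
  · intro j _ hj
    exact ((hind.indepFun hj.symm).comp (φ := a i) (ψ := b j) (by fun_prop)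
      (by fun_prop)).covariance_eq_zero (hLp _ i) (hLp _ j)
  · simp

/-- Mean and residuals are jointly Gaussian, as a linear image of the sample, so it suffices that
continuous linear functionals of the two are uncorrelated. -/
theorem indepFun_sampleMean_residual {n d : ℕ} (hn : 1 ≤ n) :
    IndepFun (sampleMean : Sample n d → Vec d) (fun y i => y i - sampleMean y)
      (stdSampleLaw n d) := by
  have hind : iIndepFun (fun i (y : Sample n d) => y i) (stdSampleLaw n d) :=
    iIndepFun_pi (X := fun _ x => x) fun _ => aemeasurable_id
  have hg : HasGaussianLaw (fun y : Sample n d => (fun i => y i)) (stdSampleLaw n d) := by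
    refine hind.hasGaussianLaw fun i => ⟨?_⟩
    have := (measurePreserving_eval (fun _ : Fin n => stdGaussian (Vec d)) i).map_eq
    have hmap : (stdSampleLaw n d).map (fun y => y i) = stdGaussian (Vec d) := this
    rw [hmap]; infer_instance
  let A : Sample n d →L[ℝ] Vec d := (n : ℝ)⁻¹ • ∑ i, ContinuousLinearMap.proj i
  have hA (y : Sample n d) : A y = sampleMean y := by
    simp [A, sampleMean]
  let B : Sample n d →L[ℝ] Sample n d :=
    ContinuousLinearMap.pi fun i => ContinuousLinearMap.proj i - A
  have hB (y : Sample n d) : B y = fun i => y i - sampleMean y := by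
    ext1 i; simp [B, hA]
  have hgAB : HasGaussianLaw (fun y : Sample n d => (sampleMean y, fun i => y i - sampleMean y))
      (stdSampleLaw n d) := by
    have := hg.map (A.prod B)
    have e : (A.prod B) ∘ (fun y : Sample n d => fun i => y i)
        = fun y => (sampleMean y, fun i => y i - sampleMean y) := by
      ext1 y
      simp only [Function.comp_apply, ContinuousLinearMap.prod_apply, hA, hB]
    rwa [e] at this
  refine hgAB.indepFun_of_covariance_strongDual fun L₁ L₂ => ?_
  -- `M i` are the coordinates of `L₂`, and `N i` those of `L₂` composed with the residual map:
  -- centering the data amounts to centering the coefficients, so the `N i` sum to zero.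
  let M (i : Fin n) : StrongDual ℝ (Vec d) := L₂ ∘L ContinuousLinearMap.single ℝ (fun _ => Vec d) i
  let N (i : Fin n) : StrongDual ℝ (Vec d) := M i - (n : ℝ)⁻¹ • ∑ j, M j
  have hn' : (n : ℝ) ≠ 0 := by positivity
  have hN : ∑ i, N i = 0 := by
    simp only [N, Finset.sum_sub_distrib, Finset.sum_const, Finset.card_univ, Fintype.card_fin,
      ← Nat.cast_smul_eq_nsmul ℝ, smul_smul, mul_inv_cancel₀ hn', one_smul, sub_self]
  have h1 : L₁ ∘ sampleMean = fun y : Sample n d => ∑ i, ((n : ℝ)⁻¹ • L₁) (y i) := by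
    ext y; simp [sampleMean, Finset.mul_sum]
  have h2 : (L₂ ∘ fun (y : Sample n d) i => y i - sampleMean y)
      = fun y : Sample n d => ∑ i, N i (y i) := by
    ext y
    have hL (z : Sample n d) : L₂ z = ∑ i, M i (z i) := by
      simp [M, ← map_sum, LinearMap.sum_single_apply]
    simp only [Function.comp_apply, hL, N, map_sub, _root_.sub_apply,
      Finset.sum_sub_distrib]
    congr 1
    simp only [_root_.smul_apply, _root_.sum_apply, sampleMean,
      map_smul, map_sum, ← Finset.smul_sum]
    rw [Finset.sum_comm]
  rw [h1, h2, covariance_sum_pi_dual]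
  have hLp (L : StrongDual ℝ (Vec d)) : MemLp L 2 (stdGaussian (Vec d)) :=
    IsGaussian.memLp_dual _ L 2 (by simp)
  -- The mean weights every coordinate by the same functional, so the covariances collapse to a
  -- single one against the sum of the `N i`.
  rw [← covariance_sum_right (fun i => hLp _) (hLp _)]
  have : (∑ i, (N i : Vec d → ℝ)) = 0 := by
    ext y
    have := congrArg (fun L : StrongDual ℝ (Vec d) => L y) hN
    simpa [_root_.sum_apply] using this
  rw [this, covariance_zero_right]

/-- The standard Gaussian law has a density with respect to Lebesgue measure. -/
theorem stdGaussian_eq_withDensity (d : ℕ) :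
    stdGaussian (Vec d) = (volume : Measure (Vec d)).withDensity fun v =>
      ENNReal.ofReal ((2 * Real.pi) ^ (-(d : ℝ) / 2) * Real.exp (-‖v‖ ^ 2 / 2)) := by
  set f : Vec d → ℝ := fun v => (2 * Real.pi) ^ (-(d : ℝ) / 2) * Real.exp (-‖v‖ ^ 2 / 2)
  have hf0 (v) : 0 ≤ f v := by positivity
  have hfm : Measurable f := by fun_prop
  have hfi : Integrable f := by
    have h := GaussianFourier.integrable_cexp_neg_mul_sq_norm_add (V := Vec d) (b := 1 / 2)
      (by norm_num) 0 0
    refine (h.norm.congr (ae_of_all _ fun v => ?_)).const_mul _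
    simp [Complex.norm_exp, ← Complex.ofReal_pow]
    ring_nf
  have : IsFiniteMeasure ((volume : Measure (Vec d)).withDensity fun v => ENNReal.ofReal (f v)) :=
    isFiniteMeasure_withDensity_ofReal hfi.2
  apply Measure.ext_of_charFun
  ext t
  rw [charFun_stdGaussian, charFun_apply, integral_withDensity_eq_integral_toReal_smul
    (by fun_prop) (by simp)]
  have key (v : Vec d) : (ENNReal.ofReal (f v)).toReal •
      Complex.exp ((inner ℝ v t : ℝ) * Complex.I)
      = ((2 * Real.pi) ^ (-(d : ℝ) / 2) : ℝ) *
        Complex.exp (-(1 / 2 : ℂ) * ‖v‖ ^ 2 + Complex.I * (inner ℝ t v : ℝ)) := by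
    rw [ENNReal.toReal_ofReal (hf0 v), Complex.exp_add, real_inner_comm, mul_comm Complex.I]
    simp only [f, Complex.real_smul]
    push_cast
    rw [mul_assoc]
    congr 3
    ring
  refine Eq.symm ((integral_congr_ae (ae_of_all _ key)).trans ?_)
  rw [integral_const_mul, GaussianFourier.integral_cexp_neg_mul_sq_norm_add (by norm_num),
    finrank_euclideanSpace_fin, ← mul_assoc]
  have hc : (((2 * Real.pi) ^ (-(d : ℝ) / 2) : ℝ) : ℂ) * ((Real.pi : ℂ) / (1 / 2)) ^ ((d : ℂ) / 2)
      = 1 := by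
    rw [Complex.ofReal_cpow (by positivity)]
    push_cast
    rw [show (Real.pi : ℂ) / (1 / 2) = 2 * Real.pi by ring, ← Complex.cpow_add _ _
      (by simp [Real.pi_ne_zero])]
    rw [neg_div, neg_add_cancel, Complex.cpow_zero]
  rw [hc, one_mul, Complex.I_sq]
  congr 1
  ring

/-! ### The pivot and the risk -/

theorem measurable_secondLoss {ρ : ℝ → ℝ} (hρ : Measurable ρ) {Ω : Type*} [MeasurableSpace Ω]
    {L T : Ω → ℝ} (hL : Measurable L) (hT : Measurable T) :
    Measurable fun ω => secondLoss ρ (L ω) (T ω) :=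
  (hρ.comp (hT.div hL)).ennreal_ofReal

theorem firstLoss_eq {n d : ℕ} (β : ℝ → ℝ) (μ : Vec d) {σ2 : ℝ} (h : 0 < σ2) (x : Sample n d) :
    firstLoss β μ σ2 x = β (‖√(n / σ2) • (sampleMean x - μ)‖ ^ 2) := by
  rw [firstLoss, norm_smul, mul_pow, Real.norm_eq_abs, sq_abs, Real.sq_sqrt (by positivity)]
  congr 1
  field_simp

/-- After standardization both parameters cancel, which is why constant estimates have constant
risk. -/
theorem firstLoss_const_add_smul {n d : ℕ} (hn : 1 ≤ n) (β : ℝ → ℝ) (μ : Vec d) {σ2 : ℝ}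
    (h : 0 < σ2) (y : Sample n d) :
    firstLoss β μ σ2 (fun i => μ + √σ2 • y i) = β (‖√(n : ℝ) • sampleMean y‖ ^ 2) := by
  rw [firstLoss_eq β μ h, sampleMean_const_add_smul hn, add_sub_cancel_left, smul_smul,
    ← Real.sqrt_mul (by positivity), div_mul_cancel₀ _ h.ne']

theorem measurable_firstLoss {n d : ℕ} {β : ℝ → ℝ} (hβ : Measurable fun g : Vec d => β (‖g‖ ^ 2))
    (μ : Vec d) {σ2 : ℝ} (h : 0 < σ2) :
    Measurable (firstLoss β μ σ2 : Sample n d → ℝ) := by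
  have : (firstLoss β μ σ2 : Sample n d → ℝ)
      = (fun g : Vec d => β (‖g‖ ^ 2)) ∘ fun x => √(n / σ2) • (sampleMean x - μ) :=
    funext fun x => firstLoss_eq β μ h x
  rw [this]
  exact hβ.comp ((measurable_sampleMean.sub_const μ).const_smul √(n / σ2))

theorem risk_eq_lintegral_stdSampleLaw {n d : ℕ} (hn : 1 ≤ n) {β ρ : ℝ → ℝ}
    (hβ : Measurable fun g : Vec d => β (‖g‖ ^ 2)) (hρ : Measurable ρ)
    {T : Sample n d → ℝ} (hT : Measurable T) (μ : Vec d) {σ2 : ℝ} (h : 0 < σ2) :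
    risk β ρ T μ σ2 = ∫⁻ y, secondLoss ρ (β (‖√(n : ℝ) • sampleMean y‖ ^ 2))
      (T fun i => μ + √σ2 • y i) ∂(stdSampleLaw n d) := by
  rw [risk, sampleLaw_eq_map μ h.le,
    lintegral_map (measurable_secondLoss hρ (measurable_firstLoss hβ μ h) hT) (by fun_prop)]
  simp_rw [firstLoss_const_add_smul hn β μ h]

theorem risk_const {n d : ℕ} (hn : 1 ≤ n) {β ρ : ℝ → ℝ}
    (hβ : Measurable fun g : Vec d => β (‖g‖ ^ 2)) (hρ : Measurable ρ)
    (c : ℝ) (μ : Vec d) {σ2 : ℝ} (h : 0 < σ2) :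
    risk β ρ (fun _ : Sample n d => c) μ σ2
      = ∫⁻ g, secondLoss ρ (β (‖g‖ ^ 2)) c ∂(stdGaussian (Vec d)) := by
  rw [risk_eq_lintegral_stdSampleLaw hn hβ hρ measurable_const μ h,
    ← map_sampleMean_stdSampleLaw hn,
    lintegral_map (measurable_secondLoss hρ hβ measurable_const)
      (show Measurable fun y : Sample n d => √(n : ℝ) • sampleMean y from
        measurable_sampleMean.const_smul √(n : ℝ))]

/-! ### The posterior under the flat prior -/

theorem sum_norm_sub_sq {n d : ℕ} (hn : 1 ≤ n) (x : Sample n d) (μ : Vec d) :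
    ∑ i, ‖x i - μ‖ ^ 2 = ∑ i, ‖x i - sampleMean x‖ ^ 2 + n * ‖sampleMean x - μ‖ ^ 2 := by
  have hn' : (n : ℝ) ≠ 0 := by positivity
  have h0 : ∑ i, (x i - sampleMean x) = 0 := by
    rw [Finset.sum_sub_distrib, Finset.sum_const, Finset.card_univ, Fintype.card_fin,
      ← Nat.cast_smul_eq_nsmul ℝ, sampleMean, smul_smul, mul_inv_cancel₀ hn', one_smul, sub_self]
  have h1 (i : Fin n) : ‖x i - μ‖ ^ 2 = ‖x i - sampleMean x‖ ^ 2
      + 2 * inner ℝ (x i - sampleMean x) (sampleMean x - μ) + ‖sampleMean x - μ‖ ^ 2 := by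
    rw [← norm_add_sq_real, sub_add_sub_cancel]
  simp_rw [h1]
  rw [Finset.sum_add_distrib, Finset.sum_add_distrib, ← Finset.mul_sum, ← sum_inner, h0,
    inner_zero_left, mul_zero, add_zero, Finset.sum_const, Finset.card_univ, Fintype.card_fin,
    nsmul_eq_mul]

/-- `K` collects all factors free of μ, including the residual sum of squares; what remains is the
standard Gaussian density at the pivot. -/
theorem exists_likelihood_eq {n d : ℕ} (hn : 1 ≤ n) {σ2 : ℝ} (h : 0 < σ2) (x : Sample n d) :
    ∃ K : ℝ, 0 < K ∧ ∀ μ, likelihood μ σ2 x = K * ((2 * Real.pi) ^ (-(d : ℝ) / 2) *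
      Real.exp (-‖√(n / σ2) • (sampleMean x - μ)‖ ^ 2 / 2)) := by
  refine ⟨((2 * Real.pi) ^ (-(d : ℝ) / 2))⁻¹ * ((2 * Real.pi * σ2) ^ (-(d : ℝ) / 2)) ^ n *
    Real.exp (-(∑ i, ‖x i - sampleMean x‖ ^ 2) / (2 * σ2)), by positivity, fun μ => ?_⟩
  have hpi : (2 * Real.pi) ^ (-(d : ℝ) / 2) ≠ 0 := by positivity
  rw [likelihood, Finset.prod_mul_distrib, Finset.prod_const, Finset.card_univ, Fintype.card_fin,
    ← Real.exp_sum, ← Finset.sum_div, Finset.sum_neg_distrib, sum_norm_sub_sq hn, norm_smul,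
    mul_pow, Real.norm_eq_abs, sq_abs, Real.sq_sqrt (by positivity)]
  have he : Real.exp (-(∑ i, ‖x i - sampleMean x‖ ^ 2 + n * ‖sampleMean x - μ‖ ^ 2) / (2 * σ2))
      = Real.exp (-(∑ i, ‖x i - sampleMean x‖ ^ 2) / (2 * σ2)) *
        Real.exp (-(n / σ2 * ‖sampleMean x - μ‖ ^ 2) / 2) := by
    rw [← Real.exp_add]
    congr 1
    field_simp
    ring
  rw [he]
  field_simp

theorem lintegral_comp_smul_sub {d : ℕ} {H : Vec d → ℝ≥0∞} (hH : Measurable H) {t : ℝ}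
    (ht : t ≠ 0) (a : Vec d) :
    ∫⁻ μ, H (t • (a - μ)) = ENNReal.ofReal |(t ^ d)⁻¹| * ∫⁻ g, H g := by
  rw [lintegral_sub_left_eq_self (fun y => H (t • y)) a,
    ← lintegral_map hH (measurable_const_smul t), Measure.map_addHaar_smul _ ht,
    lintegral_smul_measure, finrank_euclideanSpace_fin, smul_eq_mul]

/-- The constant `K` and the Jacobian of the change to the pivot occur in numerator and denominator
alike and cancel, leaving no dependence on the data. -/
theorem posteriorLoss_eq {n d : ℕ} (hn : 1 ≤ n) {β ρ : ℝ → ℝ}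
    (hβ : Measurable fun g : Vec d => β (‖g‖ ^ 2)) (hρ : Measurable ρ)
    {σ2 : ℝ} (h : 0 < σ2) (x : Sample n d) (c : ℝ) :
    posteriorLoss β ρ σ2 x c
      = ∫⁻ g, secondLoss ρ (β (‖g‖ ^ 2)) c ∂(stdGaussian (Vec d)) := by
  obtain ⟨K, hK, hlik⟩ := exists_likelihood_eq hn h x
  set f : Vec d → ℝ≥0∞ := fun v =>
    ENNReal.ofReal ((2 * Real.pi) ^ (-(d : ℝ) / 2) * Real.exp (-‖v‖ ^ 2 / 2)) with hf
  have hfm : Measurable f := by fun_prop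
  have ht : √(n / σ2) ≠ 0 := by positivity
  have key {J : Vec d → ℝ≥0∞} (hJ : Measurable J) :
      ∫⁻ μ, J (√(n / σ2) • (sampleMean x - μ)) * ENNReal.ofReal (likelihood μ σ2 x)
        = (ENNReal.ofReal K * ENNReal.ofReal |(√(n / σ2) ^ d)⁻¹|) *
          ∫⁻ g, J g ∂(stdGaussian (Vec d)) := by
    have hm : Measurable fun g => J g * (ENNReal.ofReal K * f g) :=
      hJ.mul (hfm.const_mul _)
    have := lintegral_comp_smul_sub hm ht (sampleMean x)
    simp_rw [hlik, ENNReal.ofReal_mul hK.le]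
    refine this.trans ?_
    rw [stdGaussian_eq_withDensity, lintegral_withDensity_eq_lintegral_mul _ hfm hJ,
      mul_comm (ENNReal.ofReal K), mul_assoc, ← lintegral_const_mul _ (hfm.mul hJ)]
    congr 1
    refine lintegral_congr fun g => ?_
    simp only [Pi.mul_apply]
    ring
  have hnum := key (measurable_secondLoss (T := fun _ => c) hρ hβ measurable_const)
  have hden := key (measurable_const (a := (1 : ℝ≥0∞)))
  simp only [one_mul, lintegral_const, measure_univ, mul_one] at hden
  simp_rw [← firstLoss_eq β _ h] at hnum
  rw [posteriorLoss, hnum, hden, mul_comm, ENNReal.mul_div_cancel_right]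
  · have : 0 < |(√(n / σ2) ^ d)⁻¹| := by positivity
    exact mul_ne_zero (ENNReal.ofReal_pos.2 hK).ne' (ENNReal.ofReal_pos.2 this).ne'
  · exact ENNReal.mul_ne_top ENNReal.ofReal_ne_top ENNReal.ofReal_ne_top

/-! ### The minimax lower bound by averaging over large balls -/

/-- If the averages over all translates are at most `S` while the truncated integrals are at least
`v`, then `v ≤ S`: balls of large radius are almost translation invariant. -/
theorem le_of_forall_lintegral_translate_le {E Ω : Type*} [NormedAddCommGroup E]
    [NormedSpace ℝ E] [FiniteDimensional ℝ E] [MeasureSpace E] [BorelSpace E]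
    [(volume : Measure E).IsAddHaarMeasure] [MeasurableSpace Ω] (Q : Measure Ω)
    [IsProbabilityMeasure Q] (γ : Measure E) [SFinite γ] {G : E → Ω × E → ℝ≥0∞}
    (hG : Measurable (Function.uncurry G)) {v S : ℝ≥0∞} {M : ℝ} (hM : 0 ≤ M)
    (hlow : ∀ w ω, v ≤ ∫⁻ u in Metric.closedBall 0 M, G w (ω, u) ∂γ)
    (hup : ∀ μ, ∫⁻ p, G (μ + p.2) p ∂(Q.prod γ) ≤ S) : v ≤ S := by
  -- Both sides bound the integral of `G` over w and p with ‖p.2‖ ≤ M: from below by fixing w, from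
  -- above by translating to μ = w − p.2, which stays in the ball of radius k.
  have hball (k : ℝ) : v * volume (Metric.ball (0 : E) (k - M))
      ≤ S * volume (Metric.ball (0 : E) k) := by
    have hGs : Measurable (Function.uncurry fun (μ : E) (p : Ω × E) => G (μ + p.2) p) :=
      hG.comp ((measurable_fst.add measurable_snd.snd).prodMk measurable_snd)
    calc v * volume (Metric.ball (0 : E) (k - M))
        = ∫⁻ _ in Metric.ball (0 : E) (k - M), v := by rw [setLIntegral_const]
      _ ≤ ∫⁻ w in Metric.ball (0 : E) (k - M),
            ∫⁻ p, G w p ∂(Q.prod (γ.restrict (Metric.closedBall 0 M))) := by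
          refine lintegral_mono fun w => ?_
          rw [lintegral_prod _ (show Measurable (G w) from hG.comp measurable_prodMk_left).aemeasurable]
          calc v = ∫⁻ _, v ∂Q := by simp
            _ ≤ _ := lintegral_mono fun ω => hlow w ω
      _ = ∫⁻ p, (∫⁻ w in Metric.ball (0 : E) (k - M), G w p)
            ∂(Q.prod (γ.restrict (Metric.closedBall 0 M))) :=
          lintegral_lintegral_swap hG.aemeasurable
      _ = ∫⁻ p in Set.univ ×ˢ Metric.closedBall 0 M,
            (∫⁻ w in Metric.ball (0 : E) (k - M), G w p) ∂(Q.prod γ) := by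
          rw [← Measure.prod_restrict, Measure.restrict_univ]
      _ ≤ ∫⁻ p in Set.univ ×ˢ Metric.closedBall 0 M,
            (∫⁻ μ in Metric.ball (0 : E) k, G (μ + p.2) p) ∂(Q.prod γ) := by
          refine setLIntegral_mono' (MeasurableSet.univ.prod measurableSet_closedBall)
            fun p hp => ?_
          rw [← lintegral_indicator measurableSet_ball, ← lintegral_indicator measurableSet_ball,
            ← lintegral_add_right_eq_self _ p.2]
          refine lintegral_mono fun μ => ?_
          by_cases hμ : μ + p.2 ∈ Metric.ball (0 : E) (k - M)
          · have hμ' : μ ∈ Metric.ball (0 : E) k := by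
              have h2 : ‖p.2‖ ≤ M := by simpa using hp.2
              rw [mem_ball_zero_iff] at hμ ⊢
              calc ‖μ‖ = ‖μ + p.2 - p.2‖ := by simp
                _ ≤ ‖μ + p.2‖ + ‖p.2‖ := norm_sub_le _ _
                _ < k := by linarith
            simp [Set.indicator_of_mem hμ, Set.indicator_of_mem hμ']
          · simp [Set.indicator_of_notMem hμ]
      _ ≤ ∫⁻ p, (∫⁻ μ in Metric.ball (0 : E) k, G (μ + p.2) p) ∂(Q.prod γ) :=
          setLIntegral_le_lintegral _ _
      _ = ∫⁻ μ in Metric.ball (0 : E) k, ∫⁻ p, G (μ + p.2) p ∂(Q.prod γ) :=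
          (lintegral_lintegral_swap hGs.aemeasurable).symm
      _ ≤ ∫⁻ _ in Metric.ball (0 : E) k, S := lintegral_mono fun μ => hup μ
      _ = S * volume (Metric.ball (0 : E) k) := by rw [setLIntegral_const]
  set D := Module.finrank ℝ E
  have hratio : ∀ᶠ k : ℝ in Filter.atTop, v * ENNReal.ofReal ((1 - M / k) ^ D) ≤ S := by
    filter_upwards [Filter.eventually_gt_atTop M] with k hk
    have hk0 : 0 < k := hM.trans_lt hk
    have hb := hball k
    have h1 : volume (Metric.ball (0 : E) 1) ≠ 0 := (Metric.measure_ball_pos _ _ one_pos).ne'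
    have h2 : volume (Metric.ball (0 : E) 1) ≠ ⊤ := measure_ball_lt_top.ne
    rw [Measure.addHaar_ball_of_pos _ _ (sub_pos.2 hk), Measure.addHaar_ball_of_pos _ _ hk0,
      ← mul_assoc, ← mul_assoc, ENNReal.mul_le_mul_iff_left h1 h2] at hb
    have h3 : ENNReal.ofReal (k ^ D) ≠ 0 := by simp [hk0]
    rw [← ENNReal.mul_le_mul_iff_left h3 ENNReal.ofReal_ne_top, mul_assoc,
      ← ENNReal.ofReal_mul' (by positivity), ← mul_pow]
    convert hb using 4
    field_simp
  refine le_of_tendsto ?_ hratio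
  have hlim : Filter.Tendsto (fun k : ℝ => (1 - M / k) ^ D) Filter.atTop (nhds 1) := by
    have : Filter.Tendsto (fun k : ℝ => M / k) Filter.atTop (nhds 0) :=
      Filter.tendsto_id.const_div_atTop M
    simpa using (this.const_sub 1).pow D
  simpa using ENNReal.Tendsto.const_mul (a := v) (ENNReal.tendsto_ofReal hlim) (by simp)

theorem le_supRisk {n d : ℕ} (hn : 1 ≤ n) {β ρ : ℝ → ℝ}
    (hβ : Measurable fun g : Vec d => β (‖g‖ ^ 2)) (hρ : Measurable ρ) {v : ℝ≥0∞} {M : ℝ}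
    (hM : 0 ≤ M) (hv : ∀ c, 0 < c → v ≤ ∫⁻ g in Metric.closedBall 0 M,
      secondLoss ρ (β (‖g‖ ^ 2)) c ∂(stdGaussian (Vec d)))
    {T : Sample n d → ℝ} (hT : IsLossEstimator T) : v ≤ supRisk β ρ T := by
  have hn' : (0 : ℝ) < n := by positivity
  set D : Sample n d → Sample n d := fun y i => √(n : ℝ) • (y i - sampleMean y) with hD
  have hDm : Measurable D := measurable_pi_lambda _ fun i =>
    ((measurable_pi_apply i).sub measurable_sampleMean).const_smul √(n : ℝ)
  have hUm : Measurable fun y : Sample n d => √(n : ℝ) • sampleMean y :=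
    measurable_sampleMean.const_smul √(n : ℝ)
  have : IsProbabilityMeasure ((stdSampleLaw n d).map D) :=
    Measure.isProbabilityMeasure_map hDm.aemeasurable
  have hind : IndepFun D (fun y => √(n : ℝ) • sampleMean y) (stdSampleLaw n d) := by
    have := (indepFun_sampleMean_residual (d := d) hn).symm
    exact this.comp (φ := fun z i => √(n : ℝ) • z i) (ψ := fun u => √(n : ℝ) • u)
      (by fun_prop) (by fun_prop)
  -- Here w plays the sample mean, `p.1` the residuals and `p.2` the pivot; the estimate does not
  -- see `p.2` once w is fixed.
  let G : Vec d → Sample n d × Vec d → ℝ≥0∞ := fun w p =>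
    secondLoss ρ (β (‖p.2‖ ^ 2)) (T fun i => w + p.1 i)
  have hG : Measurable (Function.uncurry G) := by
    refine measurable_secondLoss hρ (hβ.comp measurable_snd.snd) (hT.1.comp ?_)
    fun_prop
  refine le_of_forall_lintegral_translate_le ((stdSampleLaw n d).map D) (stdGaussian (Vec d)) hG
    hM (fun w ω => hv (T fun i => w + ω i) (hT.2 _)) fun μ => ?_
  -- With σ² = n the mean is μ plus the pivot itself, with no scale factor.
  have hrisk : risk β ρ T μ n ≤ supRisk β ρ T :=
    le_iSup_of_le μ (le_iSup_of_le (n : ℝ) (le_iSup_of_le hn' le_rfl))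
  have hGt : Measurable fun p : Sample n d × Vec d => G (μ + p.2) p := by
    refine measurable_secondLoss hρ (hβ.comp measurable_snd) (hT.1.comp ?_)
    fun_prop
  refine le_trans (le_of_eq ?_) hrisk
  rw [risk_eq_lintegral_stdSampleLaw hn hβ hρ hT.1 μ hn', ← map_sampleMean_stdSampleLaw hn,
    ← (indepFun_iff_map_prod_eq_prod_map_map hDm.aemeasurable hUm.aemeasurable).1 hind,
    lintegral_map hGt (hDm.prodMk hUm)]
  refine lintegral_congr fun y => ?_
  have hy : (fun i => μ + √(n : ℝ) • sampleMean y + D y i) = fun i => μ + √(n : ℝ) • y i := by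
    ext1 i
    rw [hD, add_assoc, ← smul_add, add_sub_cancel]
  simp only [G, hy]

/-- Every competitor has supremum risk at least v M for large M, hence at least r, which the
constant attains; strictness of the minimum gives uniqueness pointwise in x. -/
theorem isBayesMinimax_of_truncation {n d : ℕ} (hn : 1 ≤ n) {β ρ : ℝ → ℝ}
    (hβ : Measurable fun g : Vec d => β (‖g‖ ^ 2)) (hρ : Measurable ρ) {c₀ r : ℝ} (hc₀ : 0 < c₀)
    (hr : ∫⁻ g, secondLoss ρ (β (‖g‖ ^ 2)) c₀ ∂(stdGaussian (Vec d)) = ENNReal.ofReal r)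
    (hlt : ∀ c, 0 < c → c ≠ c₀ →
      ENNReal.ofReal r < ∫⁻ g, secondLoss ρ (β (‖g‖ ^ 2)) c ∂(stdGaussian (Vec d)))
    {v : ℕ → ℝ} (hv : ∀ᶠ M : ℕ in Filter.atTop, ∀ c, 0 < c →
      ENNReal.ofReal (v M) ≤ ∫⁻ g in Metric.closedBall 0 (M : ℝ),
        secondLoss ρ (β (‖g‖ ^ 2)) c ∂(stdGaussian (Vec d)))
    (hvr : Filter.Tendsto v Filter.atTop (nhds r)) : IsBayesMinimax n d β ρ c₀ r := by
  have hrisk (μ : Vec d) (σ2 : ℝ) (h : 0 < σ2) :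
      risk β ρ (fun _ : Sample n d => c₀) μ σ2 = ENNReal.ofReal r := by
    rw [risk_const hn hβ hρ c₀ μ h, hr]
  have hest : IsLossEstimator (fun _ : Sample n d => c₀) := ⟨measurable_const, fun _ => hc₀⟩
  refine ⟨fun σ2 h T => ⟨fun hT => ?_, fun hT => ?_⟩, ⟨hest, le_antisymm ?_ ?_⟩, hrisk⟩
  · funext x
    by_contra hne
    have := (hT x).2 c₀ hc₀
    rw [posteriorLoss_eq hn hβ hρ h, posteriorLoss_eq hn hβ hρ h, hr] at this
    exact absurd this (hlt _ (hT x).1 hne).not_ge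
  · subst hT
    refine fun x => ⟨hc₀, fun c hc => ?_⟩
    rw [posteriorLoss_eq hn hβ hρ h, posteriorLoss_eq hn hβ hρ h, hr]
    rcases eq_or_ne c c₀ with rfl | hne
    · rw [hr]
    · exact (hlt c hc hne).le
  · refine le_iInf₂ fun T hT => ?_
    have h1 : supRisk β ρ (fun _ : Sample n d => c₀) ≤ ENNReal.ofReal r :=
      iSup_le fun μ => iSup_le fun σ2 => iSup_le fun h => (hrisk μ σ2 h).le
    refine h1.trans (le_of_tendsto (ENNReal.tendsto_ofReal hvr) ?_)
    filter_upwards [hv] with M hM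
    exact le_supRisk hn hβ hρ (Nat.cast_nonneg M) hM hT
  · exact iInf₂_le _ hest

/-! ### Passage to real integrals -/

theorem rhoEntropy_nonneg (m : ℝ) {t : ℝ} (ht : 0 < t) : 0 ≤ rhoEntropy m t := by
  have := Real.log_le_sub_one_of_pos (Real.rpow_pos_of_pos ht m)
  rw [Real.log_rpow ht] at this
  rw [rhoEntropy]
  linarith

theorem rhoB_nonneg {t : ℝ} (ht : 0 < t) : 0 ≤ rhoB t := by
  have : rhoB t = (t - 1) ^ 2 / (2 * t) := by
    rw [rhoB]; field_simp; ring
  rw [this]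
  positivity

theorem isBayesMinimax_of_integral_truncation {n d : ℕ} (hn : 1 ≤ n) {β ρ : ℝ → ℝ}
    (hβ : Measurable fun g : Vec d => β (‖g‖ ^ 2))
    (hpos : ∀ᵐ g ∂(stdGaussian (Vec d)), 0 < β (‖g‖ ^ 2))
    (hρ : Measurable ρ) (hρ0 : ∀ t, 0 < t → 0 ≤ ρ t) {c₀ r : ℝ} (hc₀ : 0 < c₀)
    (hint : ∀ c, 0 < c → Integrable (fun g => ρ (c / β (‖g‖ ^ 2))) (stdGaussian (Vec d)))
    (hr : ∫ g, ρ (c₀ / β (‖g‖ ^ 2)) ∂(stdGaussian (Vec d)) = r)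
    (hlt : ∀ c, 0 < c → c ≠ c₀ → r < ∫ g, ρ (c / β (‖g‖ ^ 2)) ∂(stdGaussian (Vec d)))
    {v : ℕ → ℝ} (hv : ∀ᶠ M : ℕ in Filter.atTop, ∀ c, 0 < c →
      v M ≤ ∫ g in Metric.closedBall 0 (M : ℝ), ρ (c / β (‖g‖ ^ 2)) ∂(stdGaussian (Vec d)))
    (hvr : Filter.Tendsto v Filter.atTop (nhds r)) : IsBayesMinimax n d β ρ c₀ r := by
  have h0 (c : ℝ) (hc : 0 < c) : ∀ᵐ g ∂(stdGaussian (Vec d)), 0 ≤ ρ (c / β (‖g‖ ^ 2)) :=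
    hpos.mono fun g hg => hρ0 _ (div_pos hc hg)
  have hl (c : ℝ) (hc : 0 < c) :
      ∫⁻ g, secondLoss ρ (β (‖g‖ ^ 2)) c ∂(stdGaussian (Vec d))
        = ENNReal.ofReal (∫ g, ρ (c / β (‖g‖ ^ 2)) ∂(stdGaussian (Vec d))) :=
    (ofReal_integral_eq_lintegral_ofReal (hint c hc) (h0 c hc)).symm
  refine isBayesMinimax_of_truncation hn hβ hρ hc₀ (by rw [hl c₀ hc₀, hr]) (fun c hc hne => ?_)
    (v := v) ?_ hvr
  · rw [hl c hc]
    have hr0 : 0 ≤ r := hr ▸ integral_nonneg_of_ae (h0 c₀ hc₀)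
    exact (ENNReal.ofReal_lt_ofReal_iff_of_nonneg hr0).2 (hlt c hc hne)
  · filter_upwards [hv] with M hM c hc
    exact (ENNReal.ofReal_le_ofReal (hM c hc)).trans
      (ofReal_integral_eq_lintegral_ofReal (hint c hc).restrict
        (ae_restrict_of_ae (h0 c hc))).le

theorem tendsto_setIntegral_closedBall {d : ℕ} (γ : Measure (Vec d)) {f : Vec d → ℝ}
    (hf : Integrable f γ) :
    Filter.Tendsto (fun M : ℕ => ∫ g in Metric.closedBall 0 (M : ℝ), f g ∂γ) Filter.atTop
      (nhds (∫ g, f g ∂γ)) :=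
  (aecover_closedBall tendsto_natCast_atTop_atTop).integral_tendsto_of_countably_generated hf

theorem integral_pos_of_ae_pos {Ω : Type*} [MeasurableSpace Ω] {ν : Measure Ω} [NeZero ν]
    {f : Ω → ℝ} (hf : Integrable f ν) (h : ∀ᵐ ω ∂ν, 0 < f ω) : 0 < ∫ ω, f ω ∂ν := by
  have h0 : ∀ᵐ ω ∂ν, 0 ≤ f ω := h.mono fun _ => le_of_lt
  refine (integral_nonneg_of_ae h0).lt_of_ne' fun h1 => ?_
  have h2 := (integral_eq_zero_iff_of_nonneg_ae h0 hf).1 h1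
  obtain ⟨ω, hω, hω'⟩ := (h.and h2).exists
  simp only [Pi.zero_apply] at hω'
  exact hω.ne' hω'

/-! ### Expected losses in terms of moments, for finite measures so as to cover both the Gaussian
law and its restrictions to balls -/

section Integrals

variable {Ω : Type*} [MeasurableSpace Ω] {ν : Measure Ω} [IsFiniteMeasure ν] {L : Ω → ℝ}

theorem rhoEntropy_div (m : ℝ) {c l : ℝ} (hc : 0 < c) (hl : 0 < l) :
    rhoEntropy m (c / l)
      = c ^ m * l ^ (-m) + m * Real.log l - (m * Real.log c + 1) := by
  rw [rhoEntropy, Real.div_rpow hc.le hl.le, Real.log_div hc.ne' hl.ne', Real.rpow_neg hl.le]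
  ring

theorem integrable_rhoEntropy_div {m c : ℝ} (hc : 0 < c) (hL : ∀ᵐ ω ∂ν, 0 < L ω)
    (h1 : Integrable (fun ω => Real.log (L ω)) ν) (h2 : Integrable (fun ω => L ω ^ (-m)) ν) :
    Integrable (fun ω => rhoEntropy m (c / L ω)) ν :=
  (((h2.const_mul (c ^ m)).add (h1.const_mul m)).sub
    (integrable_const (m * Real.log c + 1))).congr
    (hL.mono fun _ hω => (rhoEntropy_div m hc hω).symm)

theorem integral_rhoEntropy_div {m c : ℝ} (hc : 0 < c) (hL : ∀ᵐ ω ∂ν, 0 < L ω)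
    (h1 : Integrable (fun ω => Real.log (L ω)) ν) (h2 : Integrable (fun ω => L ω ^ (-m)) ν) :
    ∫ ω, rhoEntropy m (c / L ω) ∂ν
      = c ^ m * (∫ ω, L ω ^ (-m) ∂ν) + m * (∫ ω, Real.log (L ω) ∂ν)
        - ν.real Set.univ * (m * Real.log c + 1) := by
  have h3 : Integrable (fun ω => c ^ m * L ω ^ (-m) + m * Real.log (L ω)) ν :=
    (h2.const_mul _).add (h1.const_mul _)
  rw [integral_congr_ae (hL.mono fun _ hω => rhoEntropy_div m hc hω), integral_sub h3 (integrable_const _),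
    integral_add (h2.const_mul _) (h1.const_mul _), integral_const_mul, integral_const_mul,
    integral_const, smul_eq_mul]

theorem rhoA_div (m : ℝ) {c l : ℝ} (hc : 0 < c) (hl : 0 < l) :
    rhoA m (c / l) = (c ^ m) ^ 2 * l ^ (-2 * m) - 2 * c ^ m * l ^ (-m) + 1 := by
  have h : l ^ (-2 * m) = (l ^ (-m)) ^ 2 := by
    rw [← Real.rpow_natCast, ← Real.rpow_mul hl.le]
    congr 1
    push_cast
    ring
  rw [rhoA, Real.div_rpow hc.le hl.le, h, Real.rpow_neg hl.le]
  ring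

theorem integrable_rhoA_div {m c : ℝ} (hc : 0 < c) (hL : ∀ᵐ ω ∂ν, 0 < L ω)
    (h1 : Integrable (fun ω => L ω ^ (-m)) ν) (h2 : Integrable (fun ω => L ω ^ (-2 * m)) ν) :
    Integrable (fun ω => rhoA m (c / L ω)) ν :=
  (((h2.const_mul ((c ^ m) ^ 2)).sub (h1.const_mul (2 * c ^ m))).add (integrable_const 1)).congr
    (hL.mono fun _ hω => (rhoA_div m hc hω).symm)

theorem integral_rhoA_div {m c : ℝ} (hc : 0 < c) (hL : ∀ᵐ ω ∂ν, 0 < L ω)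
    (h1 : Integrable (fun ω => L ω ^ (-m)) ν) (h2 : Integrable (fun ω => L ω ^ (-2 * m)) ν) :
    ∫ ω, rhoA m (c / L ω) ∂ν
      = (c ^ m) ^ 2 * (∫ ω, L ω ^ (-2 * m) ∂ν) - 2 * c ^ m * (∫ ω, L ω ^ (-m) ∂ν)
        + ν.real Set.univ := by
  have h3 : Integrable (fun ω => (c ^ m) ^ 2 * L ω ^ (-2 * m) - 2 * c ^ m * L ω ^ (-m)) ν :=
    (h2.const_mul _).sub (h1.const_mul _)
  rw [integral_congr_ae (hL.mono fun _ hω => rhoA_div m hc hω), integral_add h3 (integrable_const _),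
    integral_sub (h2.const_mul _) (h1.const_mul _), integral_const_mul, integral_const_mul,
    integral_const, smul_eq_mul, mul_one]

/-- No positivity is needed: with x / 0 = 0 the identity also holds at c = 0 or l = 0. -/
theorem rhoB_div (c l : ℝ) : rhoB (c / l) = c / 2 * (1 / l) + 1 / (2 * c) * l - 1 := by
  rw [rhoB, one_div_div]
  ring

theorem integrable_rhoB_div {c : ℝ} (h1 : Integrable L ν)
    (h2 : Integrable (fun ω => 1 / L ω) ν) :
    Integrable (fun ω => rhoB (c / L ω)) ν := by
  simp_rw [rhoB_div]
  exact ((h2.const_mul (c / 2)).add (h1.const_mul (1 / (2 * c)))).sub (integrable_const 1)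

theorem integral_rhoB_div {c : ℝ} (h1 : Integrable L ν) (h2 : Integrable (fun ω => 1 / L ω) ν) :
    ∫ ω, rhoB (c / L ω) ∂ν
      = c / 2 * (∫ ω, 1 / L ω ∂ν) + 1 / (2 * c) * (∫ ω, L ω ∂ν) - ν.real Set.univ := by
  simp_rw [rhoB_div]
  have h3 : Integrable (fun ω => c / 2 * (1 / L ω) + 1 / (2 * c) * L ω) ν :=
    (h2.const_mul _).add (h1.const_mul _)
  rw [integral_sub h3 (integrable_const _),
    integral_add (h2.const_mul _) (h1.const_mul _), integral_const_mul, integral_const_mul,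
    integral_const, smul_eq_mul, mul_one]

theorem rhoC_div {c l : ℝ} (hc : 0 < c) (hl : 0 < l) :
    rhoC (c / l) = Real.log l ^ 2 - 2 * Real.log c * Real.log l + Real.log c ^ 2 := by
  rw [rhoC, Real.log_div hc.ne' hl.ne']
  ring

theorem integrable_rhoC_div {c : ℝ} (hc : 0 < c) (hL : ∀ᵐ ω ∂ν, 0 < L ω)
    (h1 : Integrable (fun ω => Real.log (L ω)) ν)
    (h2 : Integrable (fun ω => Real.log (L ω) ^ 2) ν) :
    Integrable (fun ω => rhoC (c / L ω)) ν :=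
  ((h2.sub (h1.const_mul (2 * Real.log c))).add (integrable_const (Real.log c ^ 2))).congr
    (hL.mono fun _ hω => (rhoC_div hc hω).symm)

theorem integral_rhoC_div {c : ℝ} (hc : 0 < c) (hL : ∀ᵐ ω ∂ν, 0 < L ω)
    (h1 : Integrable (fun ω => Real.log (L ω)) ν)
    (h2 : Integrable (fun ω => Real.log (L ω) ^ 2) ν) :
    ∫ ω, rhoC (c / L ω) ∂ν
      = (∫ ω, Real.log (L ω) ^ 2 ∂ν) - 2 * Real.log c * (∫ ω, Real.log (L ω) ∂ν)
        + ν.real Set.univ * Real.log c ^ 2 := by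
  have h3 : Integrable (fun ω => Real.log (L ω) ^ 2 - 2 * Real.log c * Real.log (L ω)) ν :=
    h2.sub (h1.const_mul _)
  rw [integral_congr_ae (hL.mono fun _ hω => rhoC_div hc hω), integral_add h3 (integrable_const _),
    integral_sub h2 (h1.const_mul _), integral_const_mul, integral_const, smul_eq_mul]

end Integrals

theorem tendsto_real_restrict_closedBall {d : ℕ} (γ : Measure (Vec d)) [IsProbabilityMeasure γ] :
    Filter.Tendsto (fun M : ℕ => (γ.restrict (Metric.closedBall 0 (M : ℝ))).real Set.univ)
      Filter.atTop (nhds 1) := by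
  simpa using tendsto_setIntegral_closedBall γ (integrable_const (1 : ℝ))

/-! ### The four second-stage losses -/

section Cases

variable {n d : ℕ} (hn : 1 ≤ n) {β : ℝ → ℝ} (hβ : Measurable fun g : Vec d => β (‖g‖ ^ 2))
  (hpos : ∀ᵐ g ∂(stdGaussian (Vec d)), 0 < β (‖g‖ ^ 2))

include hn hβ hpos

theorem isBayesMinimax_rhoEntropy {m : ℝ} (hm : m ≠ 0)
    (h1 : Integrable (fun g => Real.log (β (‖g‖ ^ 2))) (stdGaussian (Vec d)))
    (h2 : Integrable (fun g => β (‖g‖ ^ 2) ^ (-m)) (stdGaussian (Vec d))) :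
    IsBayesMinimax n d β (rhoEntropy m)
      ((∫ g, β (‖g‖ ^ 2) ^ (-m) ∂(stdGaussian (Vec d))) ^ (-1 / m))
      (m * (∫ g, Real.log (β (‖g‖ ^ 2)) ∂(stdGaussian (Vec d)))
        + Real.log (∫ g, β (‖g‖ ^ 2) ^ (-m) ∂(stdGaussian (Vec d)))) := by
  set γ := stdGaussian (Vec d)
  set a := ∫ g, β (‖g‖ ^ 2) ^ (-m) ∂γ with ha_def
  have ha : 0 < a :=
    integral_pos_of_ae_pos h2 (hpos.mono fun g hg => Real.rpow_pos_of_pos hg _)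
  have hc0 : 0 < a ^ (-1 / m) := Real.rpow_pos_of_pos ha _
  have hc0m : (a ^ (-1 / m)) ^ m = a⁻¹ := by
    rw [← Real.rpow_mul ha.le, div_mul_cancel₀ _ hm, Real.rpow_neg_one]
  refine isBayesMinimax_of_integral_truncation (ρ := rhoEntropy m) hn hβ hpos
    (by unfold rhoEntropy; fun_prop)
    (fun t ht => rhoEntropy_nonneg m ht) hc0
    (fun c hc => integrable_rhoEntropy_div hc hpos h1 h2) ?_ (fun c hc hne => ?_)
    -- For a measure of mass p with moment b of order −m, the minimum over c is at c^m = p/b; this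
    -- is its value.
    (v := fun M => m * (∫ g in Metric.closedBall 0 (M : ℝ), Real.log (β (‖g‖ ^ 2)) ∂γ)
      + (γ.restrict (Metric.closedBall 0 (M : ℝ))).real Set.univ *
        Real.log ((∫ g in Metric.closedBall 0 (M : ℝ), β (‖g‖ ^ 2) ^ (-m) ∂γ) /
          (γ.restrict (Metric.closedBall 0 (M : ℝ))).real Set.univ)) ?_ ?_
  · rw [integral_rhoEntropy_div hc0 hpos h1 h2, ← ha_def, hc0m, Real.log_rpow ha,
      inv_mul_cancel₀ ha.ne', probReal_univ]
    field_simp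
    ring
  · rw [integral_rhoEntropy_div hc hpos h1 h2, ← ha_def, probReal_univ]
    -- Equality in log x ≤ x − 1 forces x = 1; as m ≠ 0, the power map is injective on positive c,
    -- whatever the sign of m.
    have hne' : c ^ m * a ≠ 1 := fun h => hne <| by
      rw [← Real.rpow_left_inj hc.le hc0.le hm, hc0m]
      exact eq_inv_of_mul_eq_one_left h
    have := Real.log_lt_sub_one_of_pos (by positivity) hne'
    rw [Real.log_mul (by positivity) ha.ne', Real.log_rpow hc] at this
    linarith
  · filter_upwards [(tendsto_real_restrict_closedBall γ).eventually_const_lt one_pos,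
      (tendsto_setIntegral_closedBall γ h2).eventually_const_lt ha] with M hp haM c hc
    rw [integral_rhoEntropy_div hc (ae_restrict_of_ae hpos) h1.restrict h2.restrict]
    set p := (γ.restrict (Metric.closedBall 0 (M : ℝ))).real Set.univ
    set b := ∫ g in Metric.closedBall 0 (M : ℝ), β (‖g‖ ^ 2) ^ (-m) ∂γ
    have := Real.log_le_sub_one_of_pos (x := c ^ m * (b / p)) (by positivity)
    rw [Real.log_mul (by positivity) (by positivity), Real.log_rpow hc] at this
    have h3 := mul_le_mul_of_nonneg_left this hp.le
    have h4 : p * (c ^ m * (b / p) - 1) = c ^ m * b - p := by field_simp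
    linarith
  · have hp := tendsto_real_restrict_closedBall γ
    have hb := tendsto_setIntegral_closedBall γ h2
    have hdiv := (hb.div hp one_ne_zero).log (by simpa using ha.ne')
    simpa using ((tendsto_setIntegral_closedBall γ h1).const_mul m).add (hp.mul hdiv)

theorem isBayesMinimax_rhoA {m : ℝ} (hm : m ≠ 0)
    (h1 : Integrable (fun g => β (‖g‖ ^ 2) ^ (-m)) (stdGaussian (Vec d)))
    (h2 : Integrable (fun g => β (‖g‖ ^ 2) ^ (-2 * m)) (stdGaussian (Vec d))) :
    IsBayesMinimax n d β (rhoA m)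
      (((∫ g, β (‖g‖ ^ 2) ^ (-m) ∂(stdGaussian (Vec d))) /
        ∫ g, β (‖g‖ ^ 2) ^ (-2 * m) ∂(stdGaussian (Vec d))) ^ (1 / m))
      (1 - (∫ g, β (‖g‖ ^ 2) ^ (-m) ∂(stdGaussian (Vec d))) ^ 2 /
        ∫ g, β (‖g‖ ^ 2) ^ (-2 * m) ∂(stdGaussian (Vec d))) := by
  set γ := stdGaussian (Vec d)
  set a := ∫ g, β (‖g‖ ^ 2) ^ (-m) ∂γ with ha_def
  set b := ∫ g, β (‖g‖ ^ 2) ^ (-2 * m) ∂γ with hb_def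
  have ha : 0 < a :=
    integral_pos_of_ae_pos h1 (hpos.mono fun g hg => Real.rpow_pos_of_pos hg _)
  have hb : 0 < b :=
    integral_pos_of_ae_pos h2 (hpos.mono fun g hg => Real.rpow_pos_of_pos hg _)
  have hc0 : 0 < (a / b) ^ (1 / m) := by positivity
  have hc0m : ((a / b) ^ (1 / m)) ^ m = a / b := by
    rw [← Real.rpow_mul (by positivity), div_mul_cancel₀ _ hm, Real.rpow_one]
  -- The expected loss is quadratic in s = c^m, with p the total mass.
  have hsq (s p : ℝ) {a b : ℝ} (hb : 0 < b) :
      s ^ 2 * b - 2 * s * a + p = p - a ^ 2 / b + b * (s - a / b) ^ 2 := by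
    field_simp; ring
  refine isBayesMinimax_of_integral_truncation (ρ := rhoA m) hn hβ hpos
    (by unfold rhoA; fun_prop)
    (fun t _ => sq_nonneg _) hc0
    (fun c hc => integrable_rhoA_div hc hpos h1 h2) ?_ (fun c hc hne => ?_)
    (v := fun M => (γ.restrict (Metric.closedBall 0 (M : ℝ))).real Set.univ -
      (∫ g in Metric.closedBall 0 (M : ℝ), β (‖g‖ ^ 2) ^ (-m) ∂γ) ^ 2 /
        (∫ g in Metric.closedBall 0 (M : ℝ), β (‖g‖ ^ 2) ^ (-2 * m) ∂γ)) ?_ ?_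
  · rw [integral_rhoA_div hc0 hpos h1 h2, ← ha_def, ← hb_def, hc0m, probReal_univ, hsq _ _ hb]
    simp
  · rw [integral_rhoA_div hc hpos h1 h2, ← ha_def, ← hb_def, probReal_univ, hsq _ _ hb]
    have hne' : c ^ m - a / b ≠ 0 := fun h => hne <| by
      rw [← Real.rpow_left_inj hc.le hc0.le hm, hc0m]
      exact sub_eq_zero.1 h
    have : 0 < b * (c ^ m - a / b) ^ 2 := by positivity
    linarith
  · filter_upwards [(tendsto_setIntegral_closedBall γ h2).eventually_const_lt hb] with M hM c hc
    rw [integral_rhoA_div hc (ae_restrict_of_ae hpos) h1.restrict h2.restrict, hsq _ _ hM]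
    exact le_add_of_nonneg_right (by positivity)
  · exact (tendsto_real_restrict_closedBall γ).sub
      (((tendsto_setIntegral_closedBall γ h1).pow 2).div
        (tendsto_setIntegral_closedBall γ h2) hb.ne')

theorem isBayesMinimax_rhoB
    (h1 : Integrable (fun g => β (‖g‖ ^ 2)) (stdGaussian (Vec d)))
    (h2 : Integrable (fun g => 1 / β (‖g‖ ^ 2)) (stdGaussian (Vec d))) :
    IsBayesMinimax n d β rhoB
      (√((∫ g, β (‖g‖ ^ 2) ∂(stdGaussian (Vec d))) /
        ∫ g, 1 / β (‖g‖ ^ 2) ∂(stdGaussian (Vec d))))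
      (√((∫ g, β (‖g‖ ^ 2) ∂(stdGaussian (Vec d))) *
        ∫ g, 1 / β (‖g‖ ^ 2) ∂(stdGaussian (Vec d))) - 1) := by
  set γ := stdGaussian (Vec d)
  set b := ∫ g, β (‖g‖ ^ 2) ∂γ with hb_def
  set a := ∫ g, 1 / β (‖g‖ ^ 2) ∂γ with ha_def
  have hb : 0 < b := integral_pos_of_ae_pos h1 hpos
  have ha : 0 < a := integral_pos_of_ae_pos h2 (hpos.mono fun g hg => one_div_pos.2 hg)
  have hc0 : 0 < √(b / a) := by positivity
  -- The AM–GM inequality with its exact remainder, which vanishes only at c = √(b/a).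
  have hsq (p : ℝ) {a b c : ℝ} (ha : 0 < a) (hb : 0 < b) (hc : 0 < c) :
      c / 2 * a + 1 / (2 * c) * b - p = √(b * a) - p + a * (c - √(b / a)) ^ 2 / (2 * c) := by
    have hba : √(b * a) = a * √(b / a) := by
      rw [show b * a = a ^ 2 * (b / a) by field_simp, Real.sqrt_mul (by positivity),
        Real.sqrt_sq ha.le]
    have hb' : b = a * √(b / a) ^ 2 := by
      rw [Real.sq_sqrt (by positivity)]; field_simp
    rw [hba]
    generalize √(b / a) = s at hb'
    rw [hb']
    field_simp
    ring
  refine isBayesMinimax_of_integral_truncation (ρ := rhoB) hn hβ hpos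
    (by unfold rhoB; fun_prop)
    (fun t => rhoB_nonneg) hc0
    (fun c _ => integrable_rhoB_div h1 h2) ?_ (fun c hc hne => ?_)
    (v := fun M => √((∫ g in Metric.closedBall 0 (M : ℝ), β (‖g‖ ^ 2) ∂γ) *
      (∫ g in Metric.closedBall 0 (M : ℝ), 1 / β (‖g‖ ^ 2) ∂γ)) -
        (γ.restrict (Metric.closedBall 0 (M : ℝ))).real Set.univ) ?_ ?_
  · rw [integral_rhoB_div h1 h2, ← ha_def, ← hb_def, probReal_univ, hsq _ ha hb hc0]
    simp
  · rw [integral_rhoB_div h1 h2, ← ha_def, ← hb_def, probReal_univ, hsq _ ha hb hc]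
    have hne' : c - √(b / a) ≠ 0 := sub_ne_zero.2 hne
    have : 0 < a * (c - √(b / a)) ^ 2 / (2 * c) := by positivity
    linarith
  · filter_upwards [(tendsto_setIntegral_closedBall γ h1).eventually_const_lt hb,
      (tendsto_setIntegral_closedBall γ h2).eventually_const_lt ha] with M hbM haM c hc
    rw [integral_rhoB_div h1.restrict h2.restrict, hsq _ haM hbM hc]
    exact le_add_of_nonneg_right (by positivity)
  · exact (((tendsto_setIntegral_closedBall γ h1).mul
      (tendsto_setIntegral_closedBall γ h2)).sqrt).sub (tendsto_real_restrict_closedBall γ)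

theorem isBayesMinimax_rhoC
    (h : MemLp (fun g => Real.log (β (‖g‖ ^ 2))) 2 (stdGaussian (Vec d))) :
    IsBayesMinimax n d β rhoC
      (Real.exp (∫ g, Real.log (β (‖g‖ ^ 2)) ∂(stdGaussian (Vec d))))
      (variance (fun g => Real.log (β (‖g‖ ^ 2))) (stdGaussian (Vec d))) := by
  have h1 := h.integrable (by norm_num)
  have h2 := h.integrable_sq
  rw [variance_eq_sub h]
  simp only [Pi.pow_apply]
  set γ := stdGaussian (Vec d)
  set a := ∫ g, Real.log (β (‖g‖ ^ 2)) ∂γ with ha_def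
  set b := ∫ g, Real.log (β (‖g‖ ^ 2)) ^ 2 ∂γ with hb_def
  -- The expected loss is quadratic in l = log c, with minimum at the mean a/p of log L for the
  -- normalized measure.
  have hsq (l a b : ℝ) {p : ℝ} (hp : 0 < p) :
      b - 2 * l * a + p * l ^ 2 = b - a ^ 2 / p + p * (l - a / p) ^ 2 := by
    field_simp; ring
  refine isBayesMinimax_of_integral_truncation (ρ := rhoC) hn hβ hpos
    (by unfold rhoC; exact Real.measurable_log.pow_const 2)
    (fun t _ => sq_nonneg _) (Real.exp_pos a)
    (fun c hc => integrable_rhoC_div hc hpos h1 h2) ?_ (fun c hc hne => ?_)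
    (v := fun M => (∫ g in Metric.closedBall 0 (M : ℝ), Real.log (β (‖g‖ ^ 2)) ^ 2 ∂γ) -
      (∫ g in Metric.closedBall 0 (M : ℝ), Real.log (β (‖g‖ ^ 2)) ∂γ) ^ 2 /
        (γ.restrict (Metric.closedBall 0 (M : ℝ))).real Set.univ) ?_ ?_
  · rw [integral_rhoC_div (Real.exp_pos a) hpos h1 h2, ← ha_def, ← hb_def, probReal_univ,
      Real.log_exp]
    ring
  · rw [integral_rhoC_div hc hpos h1 h2, ← ha_def, ← hb_def, probReal_univ,
      hsq _ _ _ one_pos, div_one, div_one, one_mul]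
    have hne' : Real.log c - a ≠ 0 := fun h => hne <| by
      rw [← sub_eq_zero.1 h, Real.exp_log hc]
    have : 0 < (Real.log c - a) ^ 2 := by positivity
    linarith
  · filter_upwards [(tendsto_real_restrict_closedBall γ).eventually_const_lt one_pos] with M hp c hc
    rw [integral_rhoC_div hc (ae_restrict_of_ae hpos) h1.restrict h2.restrict, hsq _ _ _ hp]
    exact le_add_of_nonneg_right (by positivity)
  · simpa using (tendsto_setIntegral_closedBall γ h2).sub
      (((tendsto_setIntegral_closedBall γ h1).pow 2).div
        (tendsto_real_restrict_closedBall γ) one_ne_zero)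

end Cases

/-! ### Transfer to the chi-squared law -/

/-- Freezing β at its value at 0 on the negative axis gives a function monotone on all of ℝ, hence
measurable. -/
theorem measurable_comp_norm_sq {d : ℕ} {β : ℝ → ℝ} (hβ : MonotoneOn β (Set.Ici 0)) :
    Measurable fun g : Vec d => β (‖g‖ ^ 2) := by
  have hm : Monotone fun z => β (max z 0) := fun x y hxy =>
    hβ (le_max_right x 0) (le_max_right y 0) (max_le_max_right 0 hxy)
  have : (fun g : Vec d => β (‖g‖ ^ 2)) = (fun z => β (max z 0)) ∘ fun g => ‖g‖ ^ 2 := by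
    ext g; simp
  rw [this]
  exact hm.measurable.comp (by fun_prop)

/-- β can vanish only at 0, and the origin is Gaussian-null because d ≥ 1. -/
theorem ae_pos_comp_norm_sq {d : ℕ} (hd : 1 ≤ d) {β : ℝ → ℝ}
    (hβ : StrictMonoOn β (Set.Ici 0)) (h0 : 0 ≤ β 0) :
    ∀ᵐ g ∂(stdGaussian (Vec d)), 0 < β (‖g‖ ^ 2) := by
  have : Nonempty (Fin d) := ⟨⟨0, hd⟩⟩
  have hne : ∀ᵐ g ∂(stdGaussian (Vec d)), g ≠ 0 := by
    rw [stdGaussian_eq_withDensity]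
    exact (withDensity_absolutelyContinuous _ _).ae_le (Measure.ae_ne volume 0)
  filter_upwards [hne] with g hg
  have hg' : 0 < ‖g‖ ^ 2 := by positivity
  exact h0.trans_lt (hβ Set.self_mem_Ici hg'.le hg')

theorem integrable_chiSq_comp {d : ℕ} {f : ℝ → ℝ} (hf : Integrable f (chiSq d)) :
    Integrable (fun g : Vec d => f (‖g‖ ^ 2)) (stdGaussian (Vec d)) :=
  hf.comp_measurable (by fun_prop)

theorem integral_chiSq {d : ℕ} {f : ℝ → ℝ} (hf : Integrable f (chiSq d)) :
    ∫ z, f z ∂(chiSq d) = ∫ g, f (‖g‖ ^ 2) ∂(stdGaussian (Vec d)) :=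
  integral_map (by fun_prop) hf.1

theorem corollary4p1 (n d : ℕ) (hn : 1 ≤ n) (hd : 1 ≤ d) (β : ℝ → ℝ)
    (hβ_ac : ∀ b : ℝ, 0 ≤ b → AbsolutelyContinuousOnInterval β 0 b)
    (hβ_mono : StrictMonoOn β (Set.Ici 0)) (hβ_nonneg : 0 ≤ β 0)
    (hβ_int : Integrable β (chiSq d)) :
    (∀ m : ℝ, m ≠ 0 →
      Integrable (fun z => Real.log (β z)) (chiSq d) →
      Integrable (fun z => β z ^ (-m)) (chiSq d) →
      IsBayesMinimax n d β (rhoEntropy m)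
        ((∫ z, β z ^ (-m) ∂(chiSq d)) ^ (-1 / m))
        (m * (∫ z, Real.log (β z) ∂(chiSq d)) + Real.log (∫ z, β z ^ (-m) ∂(chiSq d)))) ∧
    (∀ m : ℝ, m ≠ 0 →
      Integrable (fun z => β z ^ (-m)) (chiSq d) →
      Integrable (fun z => β z ^ (-2 * m)) (chiSq d) →
      IsBayesMinimax n d β (rhoA m)
        (((∫ z, β z ^ (-m) ∂(chiSq d)) / ∫ z, β z ^ (-2 * m) ∂(chiSq d)) ^ (1 / m))
        (1 - (∫ z, β z ^ (-m) ∂(chiSq d)) ^ 2 / ∫ z, β z ^ (-2 * m) ∂(chiSq d))) ∧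
    (Integrable (fun z => 1 / β z) (chiSq d) →
      IsBayesMinimax n d β rhoB
        (Real.sqrt ((∫ z, β z ∂(chiSq d)) / ∫ z, 1 / β z ∂(chiSq d)))
        (Real.sqrt ((∫ z, β z ∂(chiSq d)) * ∫ z, 1 / β z ∂(chiSq d)) - 1)) ∧
    (MemLp (fun z => Real.log (β z)) 2 (chiSq d) →
      IsBayesMinimax n d β rhoC
        (Real.exp (∫ z, Real.log (β z) ∂(chiSq d)))
        (variance (fun z => Real.log (β z)) (chiSq d))) := by
  have hβ := measurable_comp_norm_sq (d := d) hβ_mono.monotoneOn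
  have hpos := ae_pos_comp_norm_sq hd hβ_mono hβ_nonneg
  refine ⟨fun m hm h1 h2 => ?_, fun m hm h1 h2 => ?_, fun h2 => ?_, fun h => ?_⟩
  · rw [integral_chiSq h1, integral_chiSq h2]
    exact isBayesMinimax_rhoEntropy hn hβ hpos hm (integrable_chiSq_comp h1)
      (integrable_chiSq_comp h2)
  · rw [integral_chiSq h1, integral_chiSq h2]
    exact isBayesMinimax_rhoA hn hβ hpos hm (integrable_chiSq_comp h1) (integrable_chiSq_comp h2)
  · rw [integral_chiSq hβ_int, integral_chiSq h2]
    exact isBayesMinimax_rhoB hn hβ hpos (integrable_chiSq_comp hβ_int) (integrable_chiSq_comp h2)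
  · have : IsProbabilityMeasure (chiSq d) := Measure.isProbabilityMeasure_map (by fun_prop)
    rw [integral_chiSq (h.integrable (by norm_num)), chiSq, variance_map h.1.aemeasurable
      (by fun_prop)]
    exact isBayesMinimax_rhoC hn hβ hpos (h.comp_of_map (by fun_prop))
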